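/- Let $(\mathcal V,\le,\otimes,\mathrm k)$ be a unital commutative quantale with internal hom $[-,-]$. For $u,v\in\mathcal V$ write $u\ll v$ if, for all $W\subseteq\mathcal V$, $v\le\bigvee W$ implies $u\le w$ for some $w\in W$. Assume that one of the following holds: (A) $\mathrm k=\bigvee\{\varepsilon\in\mathcal V\mid \varepsilon\ll\mathrm k\}$; (B) $\mathrm k\wedge\bigvee_{i}v_i=\bigvee_i(\mathrm k\wedge v_i)$ for every family $(v_i)$ in $\mathcal V$. *Terminology.* A $\mathcal V$-normed set is a set $A$ with a map $|\cdot|:A\to\mathcal V$. A $\mathcal V$-normed map is a map $f$ with $|a|\le|fa|$ for all $a$; the category of these is $\mathsf{Set}/\!/\mathcal V$. A $\mathcal V$-normed category is a category whose (small) hom-sets are $\mathcal V$-normed with $\mathrm k\le|1_x|$ and $|f|\otimes|g|\le|g\cdot f|$; a functor $F$ is $\mathcal V$-normed if $|f|\le|Ff|$ for all morphisms $f$. The $\mathcal V$-normed category $\mathsf{Set}\|\mathcal V$ consists of $\mathcal V$-normed sets and all maps, with $|\varphi|=\bigwedge_a[|a|,|\varphi a|]$. For $\mathcal V$-normed categories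 $\mathbb X,\mathbb Y$, the $\mathcal V$-normed category $[\mathbb X,\mathbb Y]$ consists of the $\mathcal V$-normed functors and all natural transformations, with $|\alpha|=\bigwedge_x|\alpha_x|$. A sequence $s:\mathbb N\to\mathbb X$ is Cauchy if $\mathrm k\le\bigvee_N\bigwedge_{n\ge m\ge N}|s_{m,n}|$. A normed colimit of $s$ is a colimit $x$ of $s$ in the ordinary category $\mathbb X$ with a colimit cocone $(\gamma_n)$ such that, for every $y$, the canonical bijections $\mathrm{Nat}(s|_N,\Delta y)\to\mathbb X(x,y)$ (inverse to $f\mapsto(f\cdot\gamma_n)_{n\ge N}$, $N\in\mathbb N$) form a colimit cocone in $\mathsf{Set}/\!/\mathcal V$, where $s|_N$ is the restriction of $s$ to $\{N,N+1,\dots\}$ and $\mathrm{Nat}(s|_N,\Delta y)$ is normed by $|\alpha|=\bigwedge_{n\ge N}|\alpha_n|$. $\mathbb X$ is Cauchy cocomplete if every Cauchy sequence in $\mathbb X$ has a normed colimit. For a weight $\phi\in[\mathbb A^{\mathrm{op}},\mathsf{Set}\|\mathcal V]$, a $\phi$-weighted colimit of a functor $F:\mathbb A\to\mathbb X$ is an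 object $x$ with isomorphisms of $\mathcal V$-normed sets $\mathbb X(x,y)\cong\mathrm{Nat}(\phi,\mathbb X(F-,y))$, natural in $y$. Let $\mathcal P\mathbb A\subseteq[\mathbb A^{\mathrm{op}},\mathsf{Set}\|\mathcal V]$ be the full $\mathcal V$-normed subcategory of accessible presheaves, i.e. of small-weighted colimits of representables $\mathbb A(-,a)$ (for small $\mathbb A$ these are all presheaves). Let $\Phi[\mathbb A]$ be the class of those $\phi\in\mathcal P\mathbb A$ that are normed colimits in $\mathcal P\mathbb A$ of Cauchy sequences of representable presheaves (presheaves isomorphic to some $\mathbb A(-,a)$ by an isomorphism $e$ with $\mathrm k\le|e|$ and $\mathrm k\le|e^{-1}|$). **Statement.** For every $\mathcal V$-normed category $\mathbb X$ (not necessarily small) the following are equivalent: (i) $\mathbb X$ is Cauchy cocomplete; (ii) for every $\phi\in\Phi[\mathbb X]$, $\mathbb X$ has a $\phi$-weighted colimit of the identity functor of $\mathbb X$; (ii$'$) for every small $\mathcal V$-normed category $\mathbb A$, every $\mathcal V$-normed functor $F:\mathbb A\to\mathbb X$ and every $\phi\in\Phi[\mathbb A]$, $\mathbb X$ has a $\phi$-weighted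 colimit of $F$; (iii) the same as (ii$'$), only for countable $\mathbb A$ (those with countably many morphisms); (iv) the same as (ii$'$), only for those $\mathbb A$ whose underlying category is the ordered set $\mathbb N$. -/

import Mathlib

open CategoryTheory Opposite
open scoped Quantale

universe u v w u' v' z

namespace VNormed

/-! The value quantale is a complete lattice `V` with a commutative monoid structure `(V, *, 1)` whose
multiplication distributes over arbitrary joins (`IsQuantale V`).  Its internal hom is
`a ⇨ₗ b = sSup {c | c * a ≤ b}`. -/

section Quantale

variable (V : Type w) [CommMonoid V] [CompleteLattice V]

/-- `a` is totally below `b`. -/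
def TotallyBelow {V : Type w} [CompleteLattice V] (a b : V) : Prop :=
  ∀ W : Set V, b ≤ sSup W → ∃ c ∈ W, a ≤ c

/-- Condition (A): the neutral element is approximated from totally below. -/
def CondA : Prop :=
  (1 : V) = sSup {e : V | TotallyBelow e 1}

/-- Condition (B): meeting with the neutral element distributes over arbitrary joins. -/
def CondB : Prop :=
  ∀ W : Set V, (1 : V) ⊓ sSup W = ⨆ c ∈ W, 1 ⊓ c

end Quantale

/-- A `V`-normed set: a set with a function to `V`. -/
structure NormedSet (V : Type w) where
  /-- the underlying set -/
  carrier : Type v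
  /-- the norm -/
  norm : carrier → V

/-- The category `Set // V` of `V`-normed sets and `V`-normed maps. -/
instance NormedSet.category (V : Type w) [CompleteLattice V] : Category (NormedSet.{v} V) where
  Hom A B := {f : A.carrier → B.carrier // ∀ a, A.norm a ≤ B.norm (f a)}
  id A := ⟨fun a => a, fun _ => le_rfl⟩
  comp f g := ⟨fun a => g.1 (f.1 a), fun a => (f.2 a).trans (g.2 (f.1 a))⟩

/-- The objects of `Set || V`, which are again the `V`-normed sets. -/
structure NSet (V : Type w) where
  /-- the underlying `V`-normed set -/
  toNormedSet : NormedSet.{v} V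

/-- The carrier of an object of `Set || V`. -/
abbrev NSet.carrier {V : Type w} (A : NSet.{v} V) : Type v := A.toNormedSet.carrier

/-- The norm of an object of `Set || V`. -/
abbrev NSet.norm {V : Type w} (A : NSet.{v} V) : A.carrier → V := A.toNormedSet.norm

/-- The category `Set || V` of `V`-normed sets and arbitrary maps. -/
instance NSet.category (V : Type w) : Category (NSet.{v} V) where
  Hom A B := A.carrier → B.carrier
  id _ := fun a => a
  comp f g := fun a => g (f a)

/-- A `V`-normed category: a category with `V`-normed hom-sets such that
`k ≤ |1_x|` and `|f| ⊗ |g| ≤ |g ∘ f|`. -/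
class NormedCategory (V : Type w) [CommMonoid V] [CompleteLattice V] (X : Type u)
    [Category.{v} X] where
  /-- the norm of a morphism -/
  nrm : ∀ {x y : X}, (x ⟶ y) → V
  one_le_nrm_id : ∀ x : X, 1 ≤ nrm (𝟙 x)
  nrm_mul_le : ∀ {x y z : X} (f : x ⟶ y) (g : y ⟶ z), nrm f * nrm g ≤ nrm (f ≫ g)

/-- The norm of a morphism in a `V`-normed category. -/
abbrev nrm (V : Type w) [CommMonoid V] [CompleteLattice V] {X : Type u} [Category.{v} X]
    [NormedCategory V X] {x y : X} (f : x ⟶ y) : V :=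
  NormedCategory.nrm f

section Basic

variable (V : Type w) [CommMonoid V] [CompleteLattice V]

/-- The dual of a `V`-normed category; every morphism keeps its norm. -/
instance opNormedCategory (X : Type u) [Category.{v} X] [NormedCategory V X] :
    NormedCategory V Xᵒᵖ where
  nrm f := nrm V f.unop
  one_le_nrm_id x := NormedCategory.one_le_nrm_id x.unop
  nrm_mul_le f g := by
    rw [mul_comm]
    exact NormedCategory.nrm_mul_le g.unop f.unop

/-- A full subcategory of a `V`-normed category, with the same norms. -/
instance fullSubcategoryNormedCategory (X : Type u) [Category.{v} X] [NormedCategory V X]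
    (P : ObjectProperty X) : NormedCategory V P.FullSubcategory where
  nrm f := nrm V f.hom
  one_le_nrm_id x := NormedCategory.one_le_nrm_id x.obj
  nrm_mul_le f g := NormedCategory.nrm_mul_le f.hom g.hom

/-- A functor is `V`-normed if `|f| ≤ |F f|` for all morphisms `f`. -/
def IsNormedFunctor {X : Type u} [Category.{v} X] [NormedCategory V X]
    {Y : Type u'} [Category.{v'} Y] [NormedCategory V Y] (F : X ⥤ Y) : Prop :=
  ∀ ⦃x y : X⦄ (f : x ⟶ y), nrm V f ≤ nrm V (F.map f)

/-- A `V`-normed functor `X ⥤ Y`; these are the objects of the internal hom `[X, Y]`. -/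
structure NFunctor (X : Type u) [Category.{v} X] [NormedCategory V X]
    (Y : Type u') [Category.{v'} Y] [NormedCategory V Y] where
  /-- the underlying functor -/
  functor : X ⥤ Y
  isNormed : IsNormedFunctor V functor

/-- The morphisms of `[X, Y]` are all natural transformations. -/
instance NFunctor.category (X : Type u) [Category.{v} X] [NormedCategory V X]
    (Y : Type u') [Category.{v'} Y] [NormedCategory V Y] : Category (NFunctor V X Y) where
  Hom F G := F.functor ⟶ G.functor
  id F := 𝟙 F.functor
  comp α β := NatTrans.vcomp α β

variable [IsQuantale V]

/-- `Set || V` is `V`-normed by `|φ| = ⨅ a, [|a|, |φ a|]`. -/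
instance NSet.normedCategory : NormedCategory V (NSet.{v} V) where
  nrm {A B} φ := ⨅ a : A.carrier, (A.norm a ⇨ₗ B.norm (φ a))
  one_le_nrm_id A := le_iInf fun a =>
    Quantale.leftMulResiduation_le_iff_mul_le.2 (one_mul (A.norm a)).le
  nrm_mul_le {A B C} φ ψ := le_iInf fun a => by
    have h1 := Quantale.leftMulResiduation_le_iff_mul_le.1
      (iInf_le (fun a => A.norm a ⇨ₗ B.norm (φ a)) a)
    have h2 := Quantale.leftMulResiduation_le_iff_mul_le.1
      (iInf_le (fun b => B.norm b ⇨ₗ C.norm (ψ b)) (φ a))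
    refine Quantale.leftMulResiduation_le_iff_mul_le.2 ?_
    rw [mul_right_comm, mul_comm _ (⨅ b, _)]
    exact (mul_le_mul_right h1 _).trans h2

/-- The internal hom `[X, Y]` is `V`-normed by `|α| = ⨅ x, |α_x|`. -/
instance NFunctor.normedCategory (X : Type u) [Category.{v} X] [NormedCategory V X]
    (Y : Type u') [Category.{v'} Y] [NormedCategory V Y] : NormedCategory V (NFunctor V X Y) where
  nrm {F G} α := ⨅ x : X, nrm V (NatTrans.app (F := F.functor) (G := G.functor) α x)
  one_le_nrm_id F := le_iInf fun x => NormedCategory.one_le_nrm_id (F.functor.obj x)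
  nrm_mul_le {F G H} α β := le_iInf fun x =>
    (mul_le_mul' (iInf_le _ x) (iInf_le _ x)).trans
      (NormedCategory.nrm_mul_le (NatTrans.app (F := F.functor) (G := G.functor) α x)
        (NatTrans.app (F := G.functor) (G := H.functor) β x))

end Basic

section NormedColimits

variable (V : Type w) [CommMonoid V] [CompleteLattice V]
variable {X : Type u} [Category.{v} X] [NormedCategory V X]

/-- A sequence is Cauchy if `k ≤ ⨆ N, ⨅ n ≥ m ≥ N, |s_{m,n}|`. -/
def IsCauchy (s : ℕ ⥤ X) : Prop :=
  (1 : V) ≤ ⨆ N : ℕ, ⨅ (m : ℕ) (n : ℕ) (_ : N ≤ m) (h : m ≤ n), nrm V (s.map (homOfLE h))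

/-- An element of `Nat(s|_N, Δy)`, where `s|_N` is the restriction of the sequence `s` to
`{N, N+1, …}`: a cocone over `s|_N` with vertex `y`. -/
@[ext]
structure TailCocone {X : Type u} [Category.{v} X] (s : ℕ ⥤ X) (y : X) (N : ℕ) where
  /-- the components -/
  app : ∀ n : ℕ, N ≤ n → (s.obj n ⟶ y)
  naturality : ∀ (m n : ℕ) (hm : N ≤ m) (h : m ≤ n),
    s.map (homOfLE h) ≫ app n (hm.trans h) = app m hm

/-- Restriction `Nat(s|_N, Δy) → Nat(s|_M, Δy)` for `N ≤ M`. -/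
def TailCocone.restrict {X : Type u} [Category.{v} X] {s : ℕ ⥤ X} {y : X} {N M : ℕ}
    (α : TailCocone s y N) (h : N ≤ M) : TailCocone s y M where
  app n hn := α.app n (h.trans hn)
  naturality m n hm hmn := α.naturality m n (h.trans hm) hmn

/-- The `V`-normed set `Nat(s|_N, Δy)`. -/
def natTail (s : ℕ ⥤ X) (y : X) (N : ℕ) : NormedSet.{v} V where
  carrier := TailCocone s y N
  norm α := ⨅ (n : ℕ) (h : N ≤ n), nrm V (α.app n h)

/-- The sequence `N ↦ Nat(s|_N, Δy)` in `Set // V`, with restrictions as connecting maps. -/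
def natTailSeq (s : ℕ ⥤ X) (y : X) : ℕ ⥤ NormedSet.{v} V where
  obj N := natTail V s y N
  map {N _} f := ⟨fun α => TailCocone.restrict α (leOfHom f), fun α => le_iInf₂ fun n hn =>
    iInf₂_le (f := fun n (h : N ≤ n) => nrm V (TailCocone.app α n h)) n ((leOfHom f).trans hn)⟩
  map_id _ := rfl
  map_comp _ _ := rfl

/-- The hom-set `X(x, y)` as a `V`-normed set. -/
def homSet (x y : X) : NormedSet.{v} V where
  carrier := x ⟶ y
  norm f := nrm V f

/-- The cocone `γ` exhibits its vertex `x` as a normed colimit of the sequence `s`: it is a colimit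
cocone in the ordinary category `X` and, for every `y`, the canonical maps
`κ_N : Nat(s|_N, Δy) → X(x, y)`, inverse to `f ↦ (f ∘ γ_n)_{n ≥ N}`, form a colimit cocone in
`Set // V`. -/
structure IsNormedColimitCocone {s : ℕ ⥤ X} (γ : Limits.Cocone s) : Prop where
  isColimit : Nonempty (Limits.IsColimit γ)
  isNormedColimit : ∀ y : X,
    ∃ κ : natTailSeq V s y ⟶ (Functor.const ℕ).obj (homSet V γ.pt y),
      (∀ (N : ℕ) (α : TailCocone s y N) (n : ℕ) (h : N ≤ n),
        γ.ι.app n ≫ ((κ.app N).1 α : γ.pt ⟶ y) = α.app n h) ∧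
      Nonempty (Limits.IsColimit (Limits.Cocone.mk (homSet V γ.pt y) κ))

/-- The object `x` is a normed colimit of the sequence `s`. -/
def IsNormedColimit (s : ℕ ⥤ X) (x : X) : Prop :=
  ∃ γ : s ⟶ (Functor.const ℕ).obj x, IsNormedColimitCocone V (Limits.Cocone.mk x γ)

variable (X) in
/-- Every Cauchy sequence has a normed colimit. -/
def IsCauchyCocomplete : Prop :=
  ∀ s : ℕ ⥤ X, IsCauchy V s → ∃ x : X, IsNormedColimit V s x

/-- There is a `k`-isomorphism between `x` and `y`: an isomorphism `e` such that both `e` and its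
inverse have norm `≥ k`. -/
def KIsomorphic (x y : X) : Prop :=
  ∃ e : x ≅ y, 1 ≤ nrm V e.hom ∧ 1 ≤ nrm V e.inv

end NormedColimits

section Weighted

variable (V : Type w) [CommMonoid V] [CompleteLattice V] [IsQuantale V]

/-- The `V`-normed category `[Aᵒᵖ, Set || V]` of presheaves on `A`. -/
abbrev Psh (A : Type u) [Category.{v} A] [NormedCategory V A] :=
  NFunctor V Aᵒᵖ (NSet.{z} V)

variable {V} in
/-- An element of `Nat(φ, X(F-, y))`: a natural family of maps `φ a → X(F a, y)`. -/
@[ext]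
structure WeightedCocone {A : Type u} [Category.{v} A] [NormedCategory V A]
    {X : Type u'} [Category.{v'} X] (φ : Psh.{u, v, w, z} V A) (F : A ⥤ X) (y : X) where
  /-- the components -/
  app : ∀ a : A, (φ.functor.obj (op a)).carrier → (F.obj a ⟶ y)
  naturality : ∀ {a b : A} (f : a ⟶ b) (p : (φ.functor.obj (op b)).carrier),
    app a (φ.functor.map f.op p) = F.map f ≫ app b p

variable {V} in
/-- The action of `g : y ⟶ z` on `Nat(φ, X(F-, y))`. -/
def WeightedCocone.postcomp {A : Type u} [Category.{v} A] [NormedCategory V A]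
    {X : Type u'} [Category.{v'} X] {φ : Psh.{u, v, w, z} V A} {F : A ⥤ X} {y z : X}
    (c : WeightedCocone φ F y) (g : y ⟶ z) : WeightedCocone φ F z where
  app a p := c.app a p ≫ g
  naturality f p := by rw [c.naturality, Category.assoc]

/-- The norm on `Nat(φ, X(F-, y))`, namely `⨅ a, |c_a|` with `|c_a| = ⨅ p, [|p|, |c_a p|]`. -/
def WeightedCocone.nrm {A : Type u} [Category.{v} A] [NormedCategory V A]
    {X : Type u'} [Category.{v'} X] [NormedCategory V X]
    {φ : Psh.{u, v, w, z} V A} {F : A ⥤ X} {y : X} (c : WeightedCocone φ F y) : V :=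
  ⨅ (a : A) (p : (φ.functor.obj (op a)).carrier),
    ((φ.functor.obj (op a)).norm p ⇨ₗ VNormed.nrm V (c.app a p))

/-- The object `x` is a `φ`-weighted colimit of `F`: there are isomorphisms of `V`-normed sets
`X(x, y) ≅ Nat(φ, X(F-, y))`, natural in `y`. -/
def IsWeightedColimit {A : Type u} [Category.{v} A] [NormedCategory V A]
    {X : Type u'} [Category.{v'} X] [NormedCategory V X]
    (φ : Psh.{u, v, w, z} V A) (F : A ⥤ X) (x : X) : Prop :=
  ∃ e : ∀ y : X, (x ⟶ y) ≃ WeightedCocone φ F y,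
    (∀ (y : X) (f : x ⟶ y), (e y f).nrm V = nrm V f) ∧
    ∀ (y y' : X) (f : x ⟶ y) (g : y ⟶ y'), e y' (f ≫ g) = (e y f).postcomp g

variable (X : Type u) [Category.{v} X] [NormedCategory V X]

/-- The representable presheaf `X(-, x)`. -/
def representable (x : X) : Psh.{u, v, w, v} V X where
  functor :=
    { obj := fun t => ⟨homSet V t.unop x⟩
      map := fun {t _} f (h : t.unop ⟶ x) => f.unop ≫ h
      map_id := fun t => funext fun (h : t.unop ⟶ x) => Category.id_comp h
      map_comp := fun {t _ _} f g => funext fun (h : t.unop ⟶ x) =>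
        Category.assoc g.unop f.unop h }
  isNormed _ _ f := le_iInf fun h => Quantale.leftMulResiduation_le_iff_mul_le.2
    (NormedCategory.nrm_mul_le (X := X) f.unop h)

/-- The Yoneda functor `X ⥤ [Xᵒᵖ, Set || V]`, `x ↦ X(-, x)`. -/
def yonedaFunctor : X ⥤ Psh.{u, v, w, v} V X where
  obj x := representable V X x
  map {x _} f :=
    { app := fun t (h : t.unop ⟶ x) => h ≫ f
      naturality := fun s _ g => funext fun (h : s.unop ⟶ x) => Category.assoc g.unop h f }
  map_id x := NatTrans.ext (funext fun t => funext fun (h : t.unop ⟶ x) => Category.comp_id h)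
  map_comp {x _ _} f g := NatTrans.ext (funext fun t => funext fun (h : t.unop ⟶ x) =>
    (Category.assoc h f g).symm)

/-- A presheaf is accessible if it is a small-weighted colimit of representables. -/
def IsAccessible : ObjectProperty (Psh.{u, v, w, v} V X) := fun φ =>
  ∃ (A : Type v) (_ : SmallCategory.{v} A) (_ : NormedCategory V A)
    (ψ : Psh.{v, v, w, v} V A) (F : NFunctor V A X),
    IsWeightedColimit V ψ (F.functor ⋙ yonedaFunctor V X) φ

/-- The `V`-normed category `𝒫X` of accessible presheaves. -/
abbrev AccPsh := (IsAccessible V X).FullSubcategory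

variable {X} in
/-- `φ` is a normed colimit in `𝒫X` of a Cauchy sequence in `𝒫X` all of whose terms are
representable, that is, `k`-isomorphic to some `X(-, x)`. -/
def IsCauchyWeight (φ : AccPsh V X) : Prop :=
  ∃ σ : ℕ ⥤ AccPsh V X,
    (∀ n : ℕ, ∃ x : X, KIsomorphic V (σ.obj n).obj ((yonedaFunctor V X).obj x)) ∧
    IsCauchy V σ ∧ IsNormedColimit V σ φ

/-- `X` has the weighted colimit of `F` by `φ` for all `V`-normed functors `F : A ⥤ X` and all weights
`φ` that are normed colimits of Cauchy sequences of representables in `𝒫A`. -/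
def HasCauchyWeightedColimits (A : Type u') [Category.{v'} A] [NormedCategory V A] : Prop :=
  ∀ (F : NFunctor V A X) (φ : AccPsh V A), IsCauchyWeight V φ →
    ∃ x : X, IsWeightedColimit V φ.obj F.functor x

end Weighted

end VNormed

/-!
# Cauchy cocompleteness through weighted colimits

The equivalence rests on one explicit weight for every Cauchy sequence `s` in a `V`-normed
category: the presheaf `colimitPresheaf V s`, which sends `t` to the colimit in `Set` of the hom-sets
`X(t, s_n)`. An element `a` of it has at stage `n` the norm `⨆ |h|`, over the representatives
`h : t ⟶ s_n` of `a`, and its norm is the lower limit `⨆ N, ⨅ n ≥ N` of these.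

A normed colimit of `s` is a colimit with injections `γ_n` such that `|f|` is the lower limit of
`|f ∘ γ_n|` for all `f` out of it (`isNormedColimitCocone_iff`). Evaluation at the classes of the
identities of the `s_n` identifies `Nat(colimitPresheaf V s, X(F-, y))` with the cocones from `F ∘ s`
to `y`, and the Cauchy condition makes the norm of a weighted cocone the lower limit of the norms of
the components of its cocone (`SeqHom.iInf_residuation_eq_lowerLim`). So colimits of `F` weighted by
`colimitPresheaf V s` are the same as normed colimits of `F ∘ s`
(`isWeightedColimit_colimitPresheaf_iff`).

It remains to see that these presheaves are, up to `k`-isomorphism, the normed colimits of Cauchy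
sequences of representables. By the normed Yoneda lemma (`nrm_eq_norm_app_id`) the same computation
of norms shows that `colimitPresheaf V s` is the normed colimit of the presheaves `X(-, s_n)`
(`isNormedColimit_colimitPresheaf`). It is accessible even when `X` is large, being a colimit of
representables with a weight on the ordered set `ℕ` normed through `s`
(`isAccessible_of_isNormedColimit`). Conversely a Cauchy sequence of representables comes from a
Cauchy sequence in the category, and normed colimits are unique up to `k`-isomorphism
(`IsCauchyWeight.exists_kIsomorphic`).

Given this, a Cauchy sequence `s` in `X` gets its normed colimit either as a weighted colimit of the
identity functor or, after norming `ℕ` by `|m ⟶ n| = |s_{m,n}|`, as a weighted colimit of `s`.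
-/

namespace VNormed

/-! ### Lower limits in the quantale -/

section SequentialLimit

variable {V : Type w} [CompleteLattice V]

/-- The lower limit `⨆ N, ⨅ n ≥ N, c n` of a sequence in `V`. -/
def lowerLim (c : ℕ → V) : V := ⨆ N : ℕ, ⨅ (n : ℕ) (_ : N ≤ n), c n

theorem iInf_tail_le_lowerLim (c : ℕ → V) (N : ℕ) :
    ⨅ (n : ℕ) (_ : N ≤ n), c n ≤ lowerLim c :=
  le_iSup (fun N => ⨅ (n : ℕ) (_ : N ≤ n), c n) N

theorem lowerLim_const (c : V) : lowerLim (fun _ => c) = c :=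
  le_antisymm (iSup_le fun N => iInf₂_le N le_rfl)
    (le_iSup_of_le 0 (le_iInf₂ fun _ _ => le_rfl))

theorem mul_lowerLim_le [CommMonoid V] [IsQuantale V] {c d : ℕ → V} {b : V}
    (h : ∀ n, b * c n ≤ d n) :
    b * lowerLim c ≤ lowerLim d := by
  unfold lowerLim
  rw [Quantale.mul_iSup_distrib]
  exact iSup_mono fun N => le_iInf₂ fun n hn =>
    (mul_le_mul' le_rfl (iInf₂_le n hn)).trans (h n)

end SequentialLimit

/-! ### Normed colimits of sequences -/

section NormedColimits

variable {V : Type w} [CommMonoid V] [CompleteLattice V]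
variable {X : Type u} [Category.{v} X] [NormedCategory V X]

/-- The restriction `(f ∘ γ_n)_{n ≥ N}` of the cocone `f ∘ γ` to a tail of the sequence. -/
def TailCocone.ofHom {X : Type u} [Category.{v} X] {s : ℕ ⥤ X} (γ : Limits.Cocone s) {y : X}
    (f : γ.pt ⟶ y) (N : ℕ) : TailCocone s y N where
  app n _ := γ.ι.app n ≫ f
  naturality m n _ h := by rw [← Category.assoc, γ.w]

/-- A tail of a sequence has the same cocones as the sequence; this is the inverse
`κ_N : Nat(s|_N, Δy) → X(x, y)` of restriction. -/
def tailDesc {X : Type u} [Category.{v} X] {s : ℕ ⥤ X} {γ : Limits.Cocone s}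
    (hγ : Limits.IsColimit γ) {y : X} {N : ℕ} (α : TailCocone s y N) : γ.pt ⟶ y :=
  hγ.desc
    { pt := y
      ι :=
        { app := fun n => s.map (homOfLE (le_max_left n N)) ≫ α.app _ (le_max_right n N)
          naturality := fun m n h => by
            have h1 := α.naturality _ _ (le_max_right m N) (max_le_max_right N (leOfHom h))
            simp only [Functor.const_obj_obj, Functor.const_obj_map, Category.comp_id]
            rw [← h1, ← Category.assoc, ← Category.assoc, ← s.map_comp, ← s.map_comp]
            rfl } }

theorem fac_tailDesc {X : Type u} [Category.{v} X] {s : ℕ ⥤ X} {γ : Limits.Cocone s}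
    (hγ : Limits.IsColimit γ) {y : X} {N : ℕ} (α : TailCocone s y N) (n : ℕ) (h : N ≤ n) :
    γ.ι.app n ≫ tailDesc hγ α = α.app n h :=
  (hγ.fac _ n).trans (α.naturality _ _ h (le_max_left n N))

theorem hom_ext_of_tail {X : Type u} [Category.{v} X] {s : ℕ ⥤ X} {γ : Limits.Cocone s}
    (hγ : Limits.IsColimit γ) {y : X} {f g : γ.pt ⟶ y} (N : ℕ)
    (h : ∀ n, N ≤ n → γ.ι.app n ≫ f = γ.ι.app n ≫ g) : f = g :=
  hγ.hom_ext fun n => by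
    rw [← γ.w (homOfLE (le_max_left n N)), Category.assoc, Category.assoc,
      h _ (le_max_right n N)]

theorem tailDesc_ofHom {X : Type u} [Category.{v} X] {s : ℕ ⥤ X} {γ : Limits.Cocone s}
    (hγ : Limits.IsColimit γ) {y : X} (f : γ.pt ⟶ y) (N : ℕ) :
    tailDesc hγ (TailCocone.ofHom γ f N) = f :=
  hom_ext_of_tail hγ N fun n hn => fac_tailDesc hγ (TailCocone.ofHom γ f N) n hn

/-- The colimit condition in `Set // V` is an equation between norms: since the canonical maps are
bijections, the norm of `f` must be the join of the norms of its restrictions to the tails. -/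
theorem isNormedColimitCocone_iff {s : ℕ ⥤ X} (γ : Limits.Cocone s) :
    IsNormedColimitCocone V γ ↔ Nonempty (Limits.IsColimit γ) ∧
      ∀ (y : X) (f : γ.pt ⟶ y), nrm V f = lowerLim fun n => nrm V (γ.ι.app n ≫ f) := by
  constructor
  · rintro ⟨⟨hγ⟩, hn⟩
    refine ⟨⟨hγ⟩, fun y f => ?_⟩
    obtain ⟨κ, hκ, ⟨hcol⟩⟩ := hn y
    have κ_eq (N : ℕ) (α : TailCocone s y N) : (κ.app N).1 α = tailDesc hγ α :=
      hom_ext_of_tail hγ N fun n h => (hκ N α n h).trans (fac_tailDesc hγ α n h).symm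
    have κ_ofHom (N : ℕ) : (κ.app N).1 (TailCocone.ofHom γ f N) = f :=
      (κ_eq N _).trans (tailDesc_ofHom hγ f N)
    apply le_antisymm
    · -- The colimit carries the smallest norm making all `κ_N` normed: test its universal property on the same set
      -- with the desired norm.
      let B : NormedSet.{v} V :=
        ⟨γ.pt ⟶ y, fun g => lowerLim fun n => nrm V (γ.ι.app n ≫ g)⟩
      have normed (N : ℕ) (α : TailCocone s y N) :
          (natTail V s y N).norm α ≤ B.norm (tailDesc hγ α) :=
        (iInf₂_mono fun n h => (congrArg (nrm V) (fac_tailDesc hγ α n h)).ge).trans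
          (iInf_tail_le_lowerLim _ N)
      let τ : natTailSeq V s y ⟶ (Functor.const ℕ).obj B :=
        { app := fun N => ⟨fun α => tailDesc hγ α, normed N⟩
          naturality := fun N M h => Subtype.ext (funext fun α =>
            ((κ_eq _ _).symm.trans (congrFun (congrArg Subtype.val (κ.naturality h)) α)).trans
              (κ_eq _ _)) }
      let u := hcol.desc (Limits.Cocone.mk B τ)
      have hu : u.1 f = f := by
        have h : u.1 ((κ.app 0).1 (TailCocone.ofHom γ f 0))
            = tailDesc hγ (TailCocone.ofHom γ f 0) :=
          congrFun (congrArg Subtype.val (hcol.fac (Limits.Cocone.mk B τ) 0))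
            (TailCocone.ofHom γ f 0)
        rw [tailDesc_ofHom] at h
        exact (congrArg u.1 (κ_ofHom 0)).symm.trans h
      have h : nrm V f ≤ B.norm (u.1 f) := u.2 f
      rwa [hu] at h
    · refine iSup_le fun N => ((κ.app N).2 (TailCocone.ofHom γ f N)).trans ?_
      exact (congrArg (homSet V γ.pt y).norm (κ_ofHom N)).le
  · rintro ⟨⟨hγ⟩, hn⟩
    refine ⟨⟨hγ⟩, fun y => ?_⟩
    have normed (N : ℕ) (α : TailCocone s y N) :
        (natTail V s y N).norm α ≤ nrm V (tailDesc hγ α) :=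
      ((iInf₂_mono fun n h => (congrArg (nrm V) (fac_tailDesc hγ α n h)).ge).trans
        (iInf_tail_le_lowerLim _ N)).trans (hn y _).ge
    let κ : natTailSeq V s y ⟶ (Functor.const ℕ).obj (homSet V γ.pt y) :=
      { app := fun N => ⟨fun α => tailDesc hγ α, normed N⟩
        naturality := fun N M h => Subtype.ext (funext fun α =>
          hom_ext_of_tail hγ M fun n hn =>
            (fac_tailDesc hγ (TailCocone.restrict α (leOfHom h)) n hn).trans
              (fac_tailDesc hγ α n ((leOfHom h).trans hn)).symm) }
    have c_ofHom (c : Limits.Cocone (natTailSeq V s y)) (f : γ.pt ⟶ y) (N : ℕ) :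
        (c.ι.app N).1 (TailCocone.ofHom γ f N) = (c.ι.app 0).1 (TailCocone.ofHom γ f 0) :=
      congrFun (congrArg Subtype.val (c.w (homOfLE (Nat.zero_le N)))) (TailCocone.ofHom γ f 0)
    refine ⟨κ, fun N α n h => fac_tailDesc hγ α n h, ⟨?_⟩⟩
    refine
      { desc := fun c => ⟨fun f => (c.ι.app 0).1 (TailCocone.ofHom γ f 0), fun f => ?_⟩
        fac := fun c N => Subtype.ext (funext fun α => ?_)
        uniq := fun c m hm => Subtype.ext (funext fun f => ?_) }
    · refine (hn y f).le.trans (iSup_le fun N => ?_)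
      exact ((c.ι.app N).2 (TailCocone.ofHom γ f N)).trans
        (congrArg c.pt.norm (c_ofHom c f N)).le
    · refine (c_ofHom c (tailDesc hγ α) N).symm.trans (congrArg (c.ι.app N).1 ?_)
      exact TailCocone.ext (funext fun n => funext fun h => fac_tailDesc hγ α n h)
    · exact (congrArg m.1 (tailDesc_ofHom hγ f 0)).symm.trans
        (congrFun (congrArg Subtype.val (hm 0)) (TailCocone.ofHom γ f 0))

theorem isNormedColimit_iff {s : ℕ ⥤ X} {x : X} :
    IsNormedColimit V s x ↔ ∃ γ : s ⟶ (Functor.const ℕ).obj x,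
      Nonempty (Limits.IsColimit (Limits.Cocone.mk x γ)) ∧
        ∀ (y : X) (f : x ⟶ y), nrm V f = lowerLim fun n => nrm V (γ.app n ≫ f) :=
  exists_congr fun _ => isNormedColimitCocone_iff _

theorem nrm_iso_comp {x x' y : X} (e : x ≅ x') (h : 1 ≤ nrm V e.hom) (h' : 1 ≤ nrm V e.inv)
    [IsQuantale V] (f : x' ⟶ y) : nrm V (e.hom ≫ f) = nrm V f := by
  apply le_antisymm
  · refine le_trans ?_ ((NormedCategory.nrm_mul_le e.inv (e.hom ≫ f)).trans
      (by rw [e.inv_hom_id_assoc]))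
    exact (one_mul _).ge.trans (mul_le_mul' h' le_rfl)
  · exact ((one_mul _).ge.trans (mul_le_mul' h le_rfl)).trans
      (NormedCategory.nrm_mul_le e.hom f)

theorem IsNormedColimit.of_natIso [IsQuantale V] {s s' : ℕ ⥤ X} {x : X} (e : s ≅ s')
    (h : ∀ n, 1 ≤ nrm V (e.hom.app n)) (h' : ∀ n, 1 ≤ nrm V (e.inv.app n))
    (hx : IsNormedColimit V s x) : IsNormedColimit V s' x := by
  obtain ⟨γ, ⟨hγ⟩, hn⟩ := isNormedColimit_iff.1 hx
  refine isNormedColimit_iff.2 ⟨e.inv ≫ γ,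
    ⟨(Limits.IsColimit.precomposeInvEquiv e (Limits.Cocone.mk x γ)).symm hγ⟩, fun y f => ?_⟩
  rw [hn y f]
  congr 1
  funext n
  rw [NatTrans.comp_app, Category.assoc]
  exact (nrm_iso_comp (e.symm.app n) (h' n) (h n) _).symm

/-- Normed colimits are unique up to `k`-isomorphism: the comparison morphism has the norm of an
identity. -/
theorem IsNormedColimit.kIsomorphic {s : ℕ ⥤ X} {x x' : X}
    (hx : IsNormedColimit V s x) (hx' : IsNormedColimit V s x') : KIsomorphic V x x' := by
  obtain ⟨γ, ⟨hγ⟩, hn⟩ := isNormedColimit_iff.1 hx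
  obtain ⟨γ', ⟨hγ'⟩, hn'⟩ := isNormedColimit_iff.1 hx'
  refine ⟨hγ.coconePointUniqueUpToIso hγ', ?_, ?_⟩
  · rw [hn]
    refine (NormedCategory.one_le_nrm_id x').trans (le_of_eq ?_)
    rw [show (NormedCategory.nrm (𝟙 x') : V) = _ from hn' _ (𝟙 x')]
    congr 1
    funext n
    exact congrArg _ ((Category.comp_id (γ'.app n)).trans
      (hγ.comp_coconePointUniqueUpToIso_hom hγ' n).symm)
  · rw [hn']
    refine (NormedCategory.one_le_nrm_id x).trans (le_of_eq ?_)
    rw [show (NormedCategory.nrm (𝟙 x) : V) = _ from hn _ (𝟙 x)]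
    congr 1
    funext n
    exact congrArg _ ((Category.comp_id (γ.app n)).trans
      (hγ.comp_coconePointUniqueUpToIso_inv hγ' n).symm)

theorem KIsomorphic.symm {x y : X} (h : KIsomorphic V x y) : KIsomorphic V y x :=
  let ⟨e, h₁, h₂⟩ := h
  ⟨e.symm, h₂, h₁⟩

theorem isNormedColimit_const (x : X) :
    IsNormedColimit V ((Functor.const ℕ).obj x) x :=
  isNormedColimit_iff.2 ⟨𝟙 _,
    ⟨{desc := fun c => c.ι.app 0
      fac := fun c n => (Category.id_comp _).trans (by
        have := c.w (homOfLE (Nat.zero_le n))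
        rw [← this]
        exact Category.id_comp _)
      uniq := fun c m hm => (Category.id_comp m).symm.trans (hm 0)}⟩, fun y f => by
    conv_lhs => rw [← lowerLim_const (nrm V f)]
    congr 1
    funext n
    exact congrArg _ (Category.id_comp f).symm⟩

theorem IsCauchy.const (x : X) : IsCauchy V ((Functor.const ℕ).obj x) :=
  le_iSup_of_le 0 (le_iInf fun _ => le_iInf fun _ => le_iInf fun _ => le_iInf fun _ =>
    NormedCategory.one_le_nrm_id x)

theorem IsCauchy.mono {Y : Type u'} [Category.{v'} Y] [NormedCategory V Y] {s : ℕ ⥤ X}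
    {t : ℕ ⥤ Y} (hs : IsCauchy V s)
    (h : ∀ (m n : ℕ) (f : m ⟶ n), nrm V (s.map f) ≤ nrm V (t.map f)) : IsCauchy V t :=
  hs.trans (iSup_mono fun _ => iInf_mono fun _ => iInf_mono fun _ => iInf_mono fun _ =>
    iInf_mono fun _ => h _ _ _)

theorem IsNormedColimit.of_fullSubcategory {P : ObjectProperty X} {s : ℕ ⥤ P.FullSubcategory}
    {x : P.FullSubcategory} (h : IsNormedColimit V (s ⋙ P.ι) x.obj) : IsNormedColimit V s x := by
  obtain ⟨γ, ⟨hγ⟩, hn⟩ := isNormedColimit_iff.1 h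
  refine isNormedColimit_iff.2 ⟨
    { app := fun n => P.homMk (γ.app n)
      naturality := fun m n f => P.ι.map_injective (γ.naturality f) }, ⟨?_⟩,
    fun y f => hn y.obj f.hom⟩
  exact Limits.isColimitOfReflects P.ι (hγ.ofIsoColimit (Limits.Cocone.ext (Iso.refl _)))

end NormedColimits

/-! ### The normed Yoneda lemma -/

section Yoneda

variable {V : Type w} [CommMonoid V] [CompleteLattice V] [IsQuantale V]
variable {X : Type u} [Category.{v} X] [NormedCategory V X]

/-- Evaluation of a presheaf morphism `X(-, x) ⟶ G` at the identity preserves norms; this is the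
normed Yoneda lemma. -/
theorem nrm_eq_norm_app_id {x : X} {G : Psh.{u, v, w, v} V X} (α : representable V X x ⟶ G) :
    nrm V α = (G.functor.obj (op x)).norm
      (NatTrans.app (F := (representable V X x).functor) (G := G.functor) α (op x) (𝟙 x)) := by
  apply le_antisymm
  · have h := Quantale.leftMulResiduation_le_iff_mul_le.1
      ((iInf_le _ (op x)).trans (iInf_le _ (𝟙 x)) : nrm V α ≤ (nrm V (𝟙 x) ⇨ₗ _))
    exact (mul_one _).ge.trans ((mul_le_mul' le_rfl (NormedCategory.one_le_nrm_id x)).trans h)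
  · refine le_iInf fun t => le_iInf fun (h : t.unop ⟶ x) =>
      Quantale.leftMulResiduation_le_iff_mul_le.2 ?_
    have h1 := congrFun (NatTrans.naturality (F := (representable V X x).functor)
      (G := G.functor) α h.op) (𝟙 x)
    have h2 := Quantale.leftMulResiduation_le_iff_mul_le.1 ((G.isNormed h.op).trans
      (iInf_le _ (NatTrans.app (F := (representable V X x).functor) (G := G.functor) α (op x) (𝟙 x))))
    rw [mul_comm]
    refine h2.trans (le_of_eq (congrArg _ ?_))
    refine h1.symm.trans ?_
    exact congrArg (NatTrans.app (F := (representable V X x).functor) (G := G.functor) α t)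
      (Category.comp_id h)

theorem nrm_yonedaFunctor_map {x y : X} (f : x ⟶ y) :
    nrm V ((yonedaFunctor V X).map f) = nrm V f :=
  (nrm_eq_norm_app_id ((yonedaFunctor V X).map f)).trans (congrArg (nrm V) (Category.id_comp f))

variable (V X) in
/-- The Yoneda functor is fully faithful. -/
def yonedaFullyFaithful : (yonedaFunctor V X).FullyFaithful where
  preimage {x y} α := (NatTrans.app (F := (representable V X x).functor)
    (G := (representable V X y).functor) α (op x) (𝟙 x) : x ⟶ y)
  map_preimage {x y} α := NatTrans.ext (funext fun t => funext fun (h : t.unop ⟶ x) =>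
    (congrFun (NatTrans.naturality (F := (representable V X x).functor)
      (G := (representable V X y).functor) α h.op) (𝟙 x)).symm.trans
        (congrArg (NatTrans.app (F := (representable V X x).functor)
          (G := (representable V X y).functor) α t) (Category.comp_id h)))
  preimage_map f := Category.id_comp f

end Yoneda

/-! ### Colimits of hom-sets along a sequence -/

section SeqHom

variable {V : Type w} [CommMonoid V] [CompleteLattice V]
variable {X : Type u} [Category.{v} X]

/-- The colimit in `Set` of the hom-sets `X(t, s_n)`: morphisms from `t` into a term of the sequence
`s`, identified along the connecting morphisms. -/
def SeqHom (s : ℕ ⥤ X) (t : X) : Type v :=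
  Quot fun a b : Σ n, t ⟶ s.obj n => ∃ h : a.1 ⟶ b.1, a.2 ≫ s.map h = b.2

namespace SeqHom

variable {s : ℕ ⥤ X}

/-- The class of a morphism into the `n`-th term. -/
def mk {t : X} (n : ℕ) (h : t ⟶ s.obj n) : SeqHom s t := Quot.mk _ ⟨n, h⟩

theorem mk_comp_map {t : X} {m n : ℕ} (h : t ⟶ s.obj m) (f : m ⟶ n) :
    mk n (h ≫ s.map f) = mk m h :=
  (Quot.sound ⟨f, rfl⟩).symm

theorem mk_map_comp_id {m n : ℕ} (f : m ⟶ n) :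
    mk n (s.map f ≫ 𝟙 (s.obj n)) = mk m (𝟙 (s.obj m)) := by
  rw [Category.comp_id, ← Category.id_comp (s.map f), mk_comp_map]

@[elab_as_elim]
theorem ind {t : X} {P : SeqHom s t → Prop} (h : ∀ n f, P (mk n f)) (a : SeqHom s t) : P a :=
  Quot.ind (fun ⟨n, f⟩ => h n f) a

/-- Maps out of the colimit. -/
def lift {t : X} {B : Type z} (k : ∀ n, (t ⟶ s.obj n) → B)
    (hk : ∀ (m n : ℕ) (f : m ⟶ n) (h : t ⟶ s.obj m), k n (h ≫ s.map f) = k m h)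
    (a : SeqHom s t) : B :=
  Quot.lift (fun a => k a.1 a.2) (fun ⟨m, h⟩ ⟨n, _⟩ ⟨f, e⟩ =>
    (hk m n f h).symm.trans (congrArg (k n) e)) a

/-- Precomposition with a morphism. -/
def precomp {t t' : X} (g : t' ⟶ t) (a : SeqHom s t) : SeqHom s t' :=
  a.lift (fun n h => mk n (g ≫ h)) fun m n f h => by rw [← Category.assoc, mk_comp_map]

theorem precomp_id {t : X} (a : SeqHom s t) : a.precomp (𝟙 t) = a := by
  induction a using SeqHom.ind with
  | h n f => exact congrArg (mk n) (Category.id_comp f)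

theorem precomp_comp {t t' t'' : X} (g : t' ⟶ t) (f : t'' ⟶ t') (a : SeqHom s t) :
    a.precomp (f ≫ g) = (a.precomp g).precomp f := by
  induction a using SeqHom.ind with
  | h n h => exact congrArg (mk n) (Category.assoc f g h)

variable (V) [NormedCategory V X]

/-- The norm of a class is the lower limit of the norms `⨆ |h|` it has at the stages `n`, where `h`
runs over the representatives in `X(t, s_n)`; at a stage without representatives this join is
`⊥`. -/
def norm {t : X} (a : SeqHom s t) : V :=
  lowerLim fun n => ⨆ h : {h : t ⟶ s.obj n // mk n h = a}, nrm V h.1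

theorem nrm_mul_norm_le [IsQuantale V] {t t' : X} (g : t' ⟶ t) (a : SeqHom s t) :
    nrm V g * norm V a ≤ norm V (a.precomp g) := by
  refine mul_lowerLim_le fun n => ?_
  rw [Quantale.mul_iSup_distrib]
  exact iSup_le fun ⟨h, hh⟩ => le_iSup_of_le ⟨g ≫ h, by rw [← hh]; rfl⟩
    (NormedCategory.nrm_mul_le g h)

/-- The classes of the identities of a Cauchy sequence have lower limit at least `k`. -/
theorem one_le_lowerLim_norm_mk_id (hs : IsCauchy V s) :
    (1 : V) ≤ lowerLim fun n => norm V (mk n (𝟙 (s.obj n))) := by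
  refine hs.trans (iSup_mono fun N => le_iInf₂ fun m hm => ?_)
  refine le_trans (le_iInf₂ fun n hn => ?_) (iInf_tail_le_lowerLim _ m)
  refine le_iSup_of_le ⟨s.map (homOfLE hn), ?_⟩ ?_
  · rw [← Category.id_comp (s.map (homOfLE hn)), mk_comp_map]
  · exact (iInf₂_le m n).trans (iInf₂_le hm hn)

/-- The norm of a presheaf morphism out of the colimit is determined on the classes of the
identities. Here `g a` plays the role of the norm of the image of `a`. -/
theorem iInf_residuation_eq_lowerLim [IsQuantale V] (hs : IsCauchy V s)
    (g : ∀ t : X, SeqHom s t → V)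
    (hg : ∀ {t t' : X} (f : t' ⟶ t) (a : SeqHom s t), nrm V f * g t a ≤ g t' (a.precomp f)) :
    ⨅ (t : X) (a : SeqHom s t), (norm V a ⇨ₗ g t a) =
      lowerLim fun n => g (s.obj n) (mk n (𝟙 (s.obj n))) := by
  apply le_antisymm
  · refine (mul_one _).ge.trans ((mul_le_mul' le_rfl (one_le_lowerLim_norm_mk_id V hs)).trans ?_)
    exact mul_lowerLim_le fun n =>
      Quantale.leftMulResiduation_le_iff_mul_le.1 ((iInf_le _ _).trans (iInf_le _ _))
  · refine iSup_le fun N => le_iInf₂ fun t a =>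
      Quantale.leftMulResiduation_le_iff_mul_le.2 ?_
    -- compare the `N`-th tail with the norm of `a` at a stage beyond both `N` and `M`
    unfold norm lowerLim
    rw [Quantale.mul_iSup_distrib]
    refine iSup_le fun M => (mul_le_mul' (iInf₂_le (max N M) (le_max_left N M))
      (iInf₂_le (max N M) (le_max_right N M))).trans ?_
    rw [Quantale.mul_iSup_distrib]
    refine iSup_le fun ⟨h, hh⟩ => ?_
    rw [mul_comm]
    refine (hg h _).trans (le_of_eq (congrArg (g t) ?_))
    exact (congrArg (mk _) (Category.comp_id h)).trans hh

end SeqHom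

end SeqHom

/-! ### The colimit of a sequence of representable presheaves -/

section ColimitPresheaf

variable {V : Type w} [CommMonoid V] [CompleteLattice V] [IsQuantale V]
variable {X : Type u} [Category.{v} X] [NormedCategory V X]

variable (V) in
/-- The presheaf `t ↦ colim_n X(t, s_n)`, the pointwise colimit of the representable presheaves
`X(-, s_n)`. -/
def colimitPresheaf (s : ℕ ⥤ X) : Psh.{u, v, w, v} V X where
  functor :=
    { obj := fun t => ⟨⟨SeqHom s t.unop, SeqHom.norm V⟩⟩
      map := fun g (a : SeqHom s _) => a.precomp g.unop
      map_id := fun _ => funext fun a => SeqHom.precomp_id a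
      map_comp := fun f g => funext fun a => SeqHom.precomp_comp f.unop g.unop a }
  isNormed _ _ f := le_iInf fun a => Quantale.leftMulResiduation_le_iff_mul_le.2
    (SeqHom.nrm_mul_norm_le V f.unop a)

/-- Weighted cocones for the colimit presheaf of `s` are cocones over the image of `s`. -/
def weightedCoconeEquiv {Y : Type u'} [Category.{v'} Y] (s : ℕ ⥤ X) (F : X ⥤ Y) (y : Y) :
    WeightedCocone (colimitPresheaf V s) F y ≃ (s ⋙ F ⟶ (Functor.const ℕ).obj y) where
  toFun c :=
    { app := fun n => c.app (s.obj n) (SeqHom.mk n (𝟙 (s.obj n)))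
      naturality := fun m n f => by
        refine Eq.trans ?_ (Category.comp_id _).symm
        exact (c.naturality (s.map f) (SeqHom.mk n (𝟙 (s.obj n)))).symm.trans
          (congrArg (c.app (s.obj m)) (SeqHom.mk_map_comp_id f)) }
  invFun τ :=
    { app := fun t (a : SeqHom s t) => a.lift (fun n h => F.map h ≫ τ.app n) fun m n f h => by
        have := τ.naturality f
        dsimp at this
        rw [F.map_comp, Category.assoc, this, Category.comp_id]
      naturality := fun f (a : SeqHom s _) => a.ind fun n h =>
        (congrArg (· ≫ τ.app n) (F.map_comp f h)).trans (Category.assoc _ _ _) }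
  left_inv c := by
    refine WeightedCocone.ext (funext fun t => funext fun (a : SeqHom s t) => ?_)
    induction a using SeqHom.ind with
    | h n h =>
      exact (c.naturality h (SeqHom.mk n (𝟙 (s.obj n)))).symm.trans
        (congrArg (fun h => c.app t (SeqHom.mk n h)) (Category.comp_id h))
  right_inv τ := NatTrans.ext (funext fun n =>
    (congrArg (· ≫ τ.app n) (F.map_id (s.obj n))).trans (Category.id_comp _))

theorem nrm_weightedCocone_eq {Y : Type u'} [Category.{v'} Y] [NormedCategory V Y] {s : ℕ ⥤ X}
    (hs : IsCauchy V s) {F : X ⥤ Y} (hF : IsNormedFunctor V F) {y : Y}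
    (c : WeightedCocone (colimitPresheaf V s) F y) :
    c.nrm = lowerLim fun n => nrm V ((weightedCoconeEquiv s F y c).app n) :=
  SeqHom.iInf_residuation_eq_lowerLim V hs (fun t a => nrm V (c.app t a)) fun f a => by
    refine (mul_le_mul' (hF f) le_rfl).trans ((NormedCategory.nrm_mul_le _ _).trans ?_)
    exact (congrArg (nrm V) (c.naturality f a)).ge

/-- Colimits weighted by the colimit presheaf of a Cauchy sequence `s` are the normed colimits of the
image of `s`. -/
theorem isWeightedColimit_colimitPresheaf_iff {Y : Type u'} [Category.{v'} Y] [NormedCategory V Y]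
    {s : ℕ ⥤ X} (hs : IsCauchy V s) {F : X ⥤ Y} (hF : IsNormedFunctor V F) {y : Y} :
    IsWeightedColimit V (colimitPresheaf V s) F y ↔ IsNormedColimit V (s ⋙ F) y := by
  rw [isNormedColimit_iff]
  constructor
  · rintro ⟨e, he, hnat⟩
    -- the universal cocone corresponds to the identity of `y`
    have key (z : Y) (f : y ⟶ z) (n : ℕ) : (weightedCoconeEquiv s F z (e z f)).app n =
        (weightedCoconeEquiv s F y (e y (𝟙 y))).app n ≫ f := by
      conv_lhs => rw [← Category.id_comp f, hnat]
      rfl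
    refine ⟨weightedCoconeEquiv s F y (e y (𝟙 y)), ⟨?_⟩, fun z f => ?_⟩
    · refine
        { desc := fun c => (e c.pt).symm ((weightedCoconeEquiv s F c.pt).symm c.ι)
          fac := fun c n => (key _ _ n).symm.trans (congrArg (fun τ => NatTrans.app τ n) (by
            rw [Equiv.apply_symm_apply, Equiv.apply_symm_apply]))
          uniq := fun c m hm => ?_ }
      rw [Equiv.eq_symm_apply, Equiv.eq_symm_apply]
      ext n
      exact (key _ m n).trans (hm n)
    · rw [← he, nrm_weightedCocone_eq hs hF]
      exact congrArg lowerLim (funext fun n => congrArg _ (key z f n))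
  · rintro ⟨γ, ⟨hγ⟩, hn⟩
    let e (z : Y) : (y ⟶ z) ≃ WeightedCocone (colimitPresheaf V s) F z :=
      (hγ.homEquiv (W := z)).trans (weightedCoconeEquiv s F z).symm
    have app_e (z : Y) (f : y ⟶ z) (n : ℕ) :
        (weightedCoconeEquiv s F z (e z f)).app n = γ.app n ≫ f :=
      congrArg (fun τ => NatTrans.app τ n)
        ((weightedCoconeEquiv s F z).apply_symm_apply (hγ.homEquiv f))
    refine ⟨e, fun z f => ?_, fun z z' f g => ?_⟩
    · rw [nrm_weightedCocone_eq hs hF, hn]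
      simp only [app_e]
    · refine (weightedCoconeEquiv s F z').injective (NatTrans.ext (funext fun n => ?_))
      refine (app_e _ _ n).trans ((Category.assoc _ _ _).symm.trans ?_)
      exact congrArg (· ≫ g) (app_e _ f n).symm

theorem isNormedFunctor_yonedaFunctor : IsNormedFunctor V (yonedaFunctor V X) :=
  fun _ _ f => (nrm_yonedaFunctor_map f).ge

/-- The cocone of representable presheaves over the colimit presheaf, given by the classes of the
identities. -/
def colimitPresheafCocone (s : ℕ ⥤ X) : Limits.Cocone (s ⋙ yonedaFunctor V X) where
  pt := colimitPresheaf V s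
  ι :=
    { app := fun n =>
        { app := fun _ h => SeqHom.mk n h
          naturality := fun _ _ _ => rfl }
      naturality := fun m _ f => NatTrans.ext (funext fun t =>
        funext fun (h : t.unop ⟶ s.obj m) => SeqHom.mk_comp_map h f) }

/-- The colimit presheaf is the colimit of representable presheaves. -/
def isColimitColimitPresheafCocone (s : ℕ ⥤ X) :
    Limits.IsColimit (colimitPresheafCocone (V := V) s) where
  desc c :=
    { app := fun t (a : SeqHom s t.unop) =>
        a.lift (fun n h => (c.ι.app n).app t h) fun m n f h =>
          congrFun (NatTrans.congr_app (c.w f) t) h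
      naturality := fun t t' f => funext fun (a : SeqHom s t.unop) => a.ind fun n h =>
        congrFun (NatTrans.naturality (c.ι.app n) f) h }
  fac _ _ := rfl
  uniq c m hm := NatTrans.ext (funext fun t => funext fun (a : SeqHom s t.unop) => by
    induction a using SeqHom.ind with
    | h n h => exact congrFun (NatTrans.congr_app (hm n) t) h)

theorem isNormedColimit_colimitPresheaf {s : ℕ ⥤ X} (hs : IsCauchy V s) :
    IsNormedColimit V (s ⋙ yonedaFunctor V X) (colimitPresheaf V s) := by
  refine isNormedColimit_iff.2 ⟨(colimitPresheafCocone s).ι,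
    ⟨isColimitColimitPresheafCocone s⟩, fun G α => ?_⟩
  refine Eq.trans ?_ (congrArg lowerLim (funext fun n =>
    (nrm_eq_norm_app_id ((colimitPresheafCocone s).ι.app n ≫ α)).symm))
  refine Eq.trans (equivToOpposite.iInf_comp (g := fun t => nrm V (NatTrans.app
    (F := (colimitPresheaf V s).functor) (G := G.functor) α t))).symm
    (SeqHom.iInf_residuation_eq_lowerLim V hs
    (fun t a => (G.functor.obj (op t)).norm (NatTrans.app (F := (colimitPresheaf V s).functor)
      (G := G.functor) α (op t) a)) fun f a => ?_)
  have h := Quantale.leftMulResiduation_le_iff_mul_le.1 ((G.isNormed f.op).trans (iInf_le _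
    (NatTrans.app (F := (colimitPresheaf V s).functor) (G := G.functor) α _ a)))
  exact h.trans (congrArg _ (congrFun (NatTrans.naturality (F := (colimitPresheaf V s).functor)
    (G := G.functor) α f.op) a)).ge

end ColimitPresheaf

/-! ### Accessibility and Cauchy weights -/

section Accessible

variable {V : Type w} [CommMonoid V] [CompleteLattice V]

/-- The norm on the domain of a functor `F` given by `|f| = |F f|`. -/
abbrev inducedNormedCategory {A : Type u'} [Category.{v'} A] {X : Type u} [Category.{v} X]
    [NormedCategory V X] (F : A ⥤ X) : NormedCategory V A where
  nrm f := nrm V (F.map f)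
  one_le_nrm_id a := by
    rw [F.map_id]
    exact NormedCategory.one_le_nrm_id _
  nrm_mul_le f g := by
    rw [F.map_comp]
    exact NormedCategory.nrm_mul_le _ _

variable [IsQuantale V] {X : Type u} [Category.{v} X] [NormedCategory V X]

/-- Normed colimits of Cauchy sequences of representable presheaves are accessible, also over a large
category: the weight lives on the ordered set `ℕ`, normed through the sequence. -/
theorem isAccessible_of_isNormedColimit {s : ℕ ⥤ X} (hs : IsCauchy V s)
    {φ : Psh.{u, v, w, v} V X} (h : IsNormedColimit V (s ⋙ yonedaFunctor V X) φ) :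
    IsAccessible V X φ := by
  let _ : NormedCategory V (AsSmall.{v} ℕ) := inducedNormedCategory (AsSmall.down ⋙ s)
  refine ⟨AsSmall.{v} ℕ, inferInstance, inferInstance, colimitPresheaf V AsSmall.up,
    ⟨AsSmall.down ⋙ s, fun _ _ _ => le_rfl⟩, ?_⟩
  exact (isWeightedColimit_colimitPresheaf_iff (s := AsSmall.up)
    (F := (AsSmall.down ⋙ s) ⋙ yonedaFunctor V X) (hs.mono fun _ _ _ => le_rfl)
    fun _ _ f => isNormedFunctor_yonedaFunctor (s.map f.down)).2 h

theorem isAccessible_colimitPresheaf {s : ℕ ⥤ X} (hs : IsCauchy V s) :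
    IsAccessible V X (colimitPresheaf V s) :=
  isAccessible_of_isNormedColimit hs (isNormedColimit_colimitPresheaf hs)

theorem isAccessible_yonedaFunctor_obj (x : X) :
    IsAccessible V X ((yonedaFunctor V X).obj x) :=
  isAccessible_of_isNormedColimit (IsCauchy.const x)
    ((isNormedColimit_const ((yonedaFunctor V X).obj x)).of_natIso
      (Functor.constComp ℕ x (yonedaFunctor V X)).symm
      (fun _ => NormedCategory.one_le_nrm_id ((yonedaFunctor V X).obj x))
      (fun _ => NormedCategory.one_le_nrm_id ((yonedaFunctor V X).obj x)))

variable (V X) in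
/-- The Yoneda functor into accessible presheaves. -/
def yonedaAcc : X ⥤ AccPsh V X :=
  (IsAccessible V X).lift (yonedaFunctor V X) isAccessible_yonedaFunctor_obj

theorem isNormedColimit_yonedaAcc {s : ℕ ⥤ X} (hs : IsCauchy V s) :
    IsNormedColimit V (s ⋙ yonedaAcc V X)
      ⟨colimitPresheaf V s, isAccessible_colimitPresheaf hs⟩ :=
  IsNormedColimit.of_fullSubcategory (isNormedColimit_colimitPresheaf hs)

theorem isCauchyWeight_colimitPresheaf {s : ℕ ⥤ X} (hs : IsCauchy V s) :
    IsCauchyWeight V (⟨colimitPresheaf V s, isAccessible_colimitPresheaf hs⟩ : AccPsh V X) :=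
  ⟨s ⋙ yonedaAcc V X, fun n => ⟨s.obj n, Iso.refl _, NormedCategory.one_le_nrm_id _,
    NormedCategory.one_le_nrm_id _⟩,
    hs.mono fun _ _ f => isNormedFunctor_yonedaFunctor (s.map f), isNormedColimit_yonedaAcc hs⟩

/-- Every normed colimit of a Cauchy sequence of representable presheaves is, up to
`k`-isomorphism, the colimit presheaf of a Cauchy sequence: the Yoneda functor is fully faithful and
preserves norms, so the given sequence comes from one in `X`. -/
theorem IsCauchyWeight.exists_kIsomorphic {φ : AccPsh V X} (hφ : IsCauchyWeight V φ) :
    ∃ s : ℕ ⥤ X, IsCauchy V s ∧ KIsomorphic V φ.obj (colimitPresheaf V s) := by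
  obtain ⟨σ, hσ, hc, hcol⟩ := hφ
  choose x e he he' using hσ
  let Y := yonedaFullyFaithful V X
  let s : ℕ ⥤ X :=
    { obj := x
      map := fun {m n} f => Y.preimage ((e m).inv ≫ (σ.map f).hom ≫ (e n).hom)
      map_id := fun n => Y.map_injective (by simp)
      map_comp := fun f g => Y.map_injective (by simp) }
  have map_s {m n : ℕ} (f : m ⟶ n) :
      (yonedaFunctor V X).map (s.map f) = (e m).inv ≫ (σ.map f).hom ≫ (e n).hom :=
    Y.map_preimage ((e m).inv ≫ (σ.map f).hom ≫ (e n).hom)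
  have hs : IsCauchy V s := hc.mono fun m n f => by
    rw [← nrm_yonedaFunctor_map (s.map f), map_s]
    calc nrm V (σ.map f).hom = 1 * (nrm V (σ.map f).hom * 1) := by rw [one_mul, mul_one]
      _ ≤ nrm V (e m).inv * (nrm V (σ.map f).hom * nrm V (e n).hom) :=
        mul_le_mul' (he' m) (mul_le_mul' le_rfl (he n))
      _ ≤ nrm V (e m).inv * nrm V ((σ.map f).hom ≫ (e n).hom) :=
        mul_le_mul' le_rfl (NormedCategory.nrm_mul_le _ _)
      _ ≤ _ := NormedCategory.nrm_mul_le _ _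
  let i : σ ≅ s ⋙ yonedaAcc V X :=
    NatIso.ofComponents (fun n => (IsAccessible V X).isoMk (e n)) fun {m n} f =>
      (IsAccessible V X).ι.map_injective (by
        refine Eq.trans ?_ (congrArg ((e m).hom ≫ ·) (map_s f)).symm
        exact ((e m).hom_inv_id_assoc _).symm)
  obtain ⟨k, hk, hk'⟩ := (hcol.of_natIso i he he').kIsomorphic (isNormedColimit_yonedaAcc hs)
  exact ⟨s, hs, (IsAccessible V X).ι.mapIso k, hk, hk'⟩

end Accessible

/-! ### Invariance under isomorphism of weights -/

section Weights

variable {V : Type w} [CommMonoid V] [CompleteLattice V] [IsQuantale V]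
variable {A : Type u} [Category.{v} A] [NormedCategory V A]
variable {X : Type u'} [Category.{v'} X]

/-- The action of a morphism of weights on weighted cocones. -/
def WeightedCocone.precomp {φ ψ : Psh.{u, v, w, z} V A} {F : A ⥤ X} {y : X}
    (β : ψ ⟶ φ) (c : WeightedCocone φ F y) : WeightedCocone ψ F y where
  app a p := c.app a (NatTrans.app (F := ψ.functor) (G := φ.functor) β (op a) p)
  naturality f p :=
    (congrArg (c.app _) (congrFun (NatTrans.naturality (F := ψ.functor) (G := φ.functor) β f.op)
      p)).trans (c.naturality f _)

/-- Isomorphic weights have the same weighted cocones. -/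
def WeightedCocone.precompEquiv {φ ψ : Psh.{u, v, w, z} V A} (e : φ ≅ ψ) (F : A ⥤ X) (y : X) :
    WeightedCocone φ F y ≃ WeightedCocone ψ F y where
  toFun := precomp e.inv
  invFun := precomp e.hom
  left_inv c := WeightedCocone.ext (funext fun a => funext fun p =>
    congrArg (c.app a) (congrFun (NatTrans.congr_app (F := φ.functor) (G := φ.functor)
      e.hom_inv_id (op a)) p))
  right_inv c := WeightedCocone.ext (funext fun a => funext fun p =>
    congrArg (c.app a) (congrFun (NatTrans.congr_app (F := ψ.functor) (G := ψ.functor)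
      e.inv_hom_id (op a)) p))

variable [NormedCategory V X]

theorem WeightedCocone.nrm_le_nrm_precomp {φ ψ : Psh.{u, v, w, z} V A} {F : A ⥤ X} {y : X}
    (β : ψ ⟶ φ) (hβ : 1 ≤ VNormed.nrm V β) (c : WeightedCocone φ F y) :
    c.nrm ≤ (c.precomp β).nrm := by
  refine le_iInf₂ fun a p => Quantale.leftMulResiduation_le_iff_mul_le.2 ?_
  have h := Quantale.leftMulResiduation_le_iff_mul_le.1
    ((hβ.trans (iInf_le _ (op a))).trans (iInf_le _ p))
  rw [one_mul] at h
  exact (mul_le_mul' le_rfl h).trans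
    (Quantale.leftMulResiduation_le_iff_mul_le.1 (iInf₂_le a _))

theorem IsWeightedColimit.of_kIsomorphic {φ ψ : Psh.{u, v, w, z} V A} (h : KIsomorphic V φ ψ)
    {F : A ⥤ X} {x : X} (hx : IsWeightedColimit V φ F x) : IsWeightedColimit V ψ F x := by
  obtain ⟨e, he, he'⟩ := h
  obtain ⟨E, hE, hE'⟩ := hx
  refine ⟨fun y => (E y).trans (WeightedCocone.precompEquiv e F y), fun y f => ?_,
    fun y y' f g => congrArg (WeightedCocone.precomp e.inv) (hE' y y' f g)⟩
  rw [← hE y f]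
  apply le_antisymm
  · refine (WeightedCocone.nrm_le_nrm_precomp e.hom he _).trans (le_of_eq (congrArg _ ?_))
    exact (WeightedCocone.precompEquiv e F y).symm_apply_apply (E y f)
  · exact WeightedCocone.nrm_le_nrm_precomp e.inv he' _

end Weights

/-! ### Cauchy cocompleteness and Cauchy weights -/

section Cocompleteness

variable {V : Type w} [CommMonoid V] [CompleteLattice V] [IsQuantale V]
variable {A : Type u} [Category.{v} A] [NormedCategory V A]
variable {X : Type u'} [Category.{v'} X] [NormedCategory V X]

theorem IsCauchyCocomplete.hasCauchyWeightedColimits (hX : IsCauchyCocomplete V X) :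
    HasCauchyWeightedColimits V X A := fun F φ hφ => by
  obtain ⟨s, hs, hk⟩ := hφ.exists_kIsomorphic
  obtain ⟨x, hx⟩ := hX (s ⋙ F.functor) (hs.mono fun _ _ f => F.isNormed (s.map f))
  exact ⟨x, ((isWeightedColimit_colimitPresheaf_iff hs F.isNormed).2 hx).of_kIsomorphic hk.symm⟩

theorem exists_isNormedColimit_of_weighted {F : A ⥤ X} (hF : IsNormedFunctor V F)
    (h : ∀ φ : AccPsh V A, IsCauchyWeight V φ → ∃ x : X, IsWeightedColimit V φ.obj F x)
    {s : ℕ ⥤ A} (hs : IsCauchy V s) : ∃ x : X, IsNormedColimit V (s ⋙ F) x :=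
  (h _ (isCauchyWeight_colimitPresheaf hs)).imp fun _ =>
    (isWeightedColimit_colimitPresheaf_iff hs hF).1

end Cocompleteness

end VNormed

theorem mainTheorem7 (V : Type w) [CommMonoid V] [CompleteLattice V] [IsQuantale V]
    (hV : VNormed.CondA V ∨ VNormed.CondB V)
    (X : Type u) [Category.{v} X] [VNormed.NormedCategory V X] :
    List.TFAE [
      -- `X` is Cauchy cocomplete
      VNormed.IsCauchyCocomplete V X,
      -- `X` has all `φ`-weighted colimits (of the identity functor), `φ` in `𝒫X` a normed colimit of a
      -- Cauchy sequence of representables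
      ∀ φ : VNormed.AccPsh V X, VNormed.IsCauchyWeight V φ →
        ∃ x : X, VNormed.IsWeightedColimit V φ.obj (𝟭 X) x,
      -- the same for diagrams of arbitrary small shape
      ∀ (A : Type v) [SmallCategory.{v} A] [VNormed.NormedCategory V A],
        VNormed.HasCauchyWeightedColimits V X A,
      -- the same for diagrams of countable shape
      ∀ (A : Type v) [SmallCategory.{v} A] [VNormed.NormedCategory V A] [CountableCategory A],
        VNormed.HasCauchyWeightedColimits V X A,
      -- the same for diagrams whose shape has the ordered set `ℕ` as its underlying category
      ∀ [VNormed.NormedCategory V (AsSmall.{v} ℕ)],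
        VNormed.HasCauchyWeightedColimits V X (AsSmall.{v} ℕ)] := by
  tfae_have 1 → 2 := fun h φ hφ => h.hasCauchyWeightedColimits ⟨𝟭 X, fun _ _ _ => le_rfl⟩ φ hφ
  tfae_have 2 → 1 := fun h _ hs =>
    VNormed.exists_isNormedColimit_of_weighted (F := 𝟭 X) (fun _ _ _ => le_rfl) h hs
  tfae_have 1 → 3 := fun h A _ _ => h.hasCauchyWeightedColimits
  tfae_have 3 → 4 := fun h A _ _ _ => h A
  tfae_have 4 → 5 := by
    intro h _
    have : CountableCategory (AsSmall.{v} ℕ) :=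
      { countableObj := inferInstanceAs (Countable (ULift ℕ))
        countableHom := fun i j => inferInstanceAs (Countable (ULift (ULift.down i ⟶ ULift.down j))) }
    exact h _
  -- Norm `ℕ` so that `s` preserves norms; `s` is then the image of a Cauchy sequence in `ℕ`.
  tfae_have 5 → 1 := fun h s hs =>
    let _ : VNormed.NormedCategory V (AsSmall.{v} ℕ) :=
      VNormed.inducedNormedCategory (AsSmall.down ⋙ s)
    VNormed.exists_isNormedColimit_of_weighted (F := AsSmall.down ⋙ s) (fun _ _ _ => le_rfl)
      (h ⟨AsSmall.down ⋙ s, fun _ _ _ => le_rfl⟩) (s := AsSmall.up) (hs.mono fun _ _ _ => le_rfl)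
  tfae_finish
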